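/- For a real number $\alpha$ and $n\ge 1$ put $P_n(\alpha)=\prod_{r=1}^{n}|2\sin \pi r\alpha|$. For an irrational $\alpha\in(0,1)$ write $\alpha=[0;a_1,a_2,\dots]$ for its (infinite) regular continued fraction expansion, with positive integer coefficients $a_j$. (i) There is a natural number $M_0$ such that for every integer $M\ge M_0$ there is a threshold $K=K(M)\in\{1,\dots,M\}$ with the following property: for every irrational $\alpha=[0;a_1,a_2,\dots]\in(0,1)$ with bounded continued fraction coefficients and $\max_{j\ge 1}a_j=M$, if $a_j\ge K$ for infinitely many $j$, then $$\liminf_{n\to\infty}P_n(\alpha)=0 .$$ (ii) More explicitly, whenever $1\le K\le M$ are integers with $$802+\frac{151\log M}{K}-\log K<0,$$ then $\liminf_{n\to\infty}P_n(\alpha)=0$ for every irrational $\alpha=[0;a_1,a_2,\dots]\in(0,1)$ with $\max_{j\ge1}a_j=M$ and $a_j\ge K$ for infinitely many $j$. -/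

import Mathlib

/-- The trigonometric (Sudler) product `P_n(α) = ∏_{r=1}^n |2 sin (π r α)|`. -/
noncomputable def sudlerProduct (n : ℕ) (α : ℝ) : ℝ :=
  ∏ r ∈ Finset.Icc 1 n, |2 * Real.sin (Real.pi * r * α)|

/-- `α = [0; a₁, a₂, a₃, …]`: the regular continued fraction of `α` is infinite, has integer part
`0`, and its `j`-th partial quotient is `a j` for every `j ≥ 1` (Mathlib numbers the partial
denominators from `0`). The value `a 0` plays no role. -/
structure HasContFracCoeffs (α : ℝ) (a : ℕ → ℕ) : Prop where
  intPart : (GenContFract.of α).h = 0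
  coeff : ∀ j : ℕ, (GenContFract.of α).partDens.get? j = some (a (j + 1) : ℝ)

/-!
Let `p / q` be the convergent of `α` just before a partial quotient `L` that is at least as large as
all the earlier ones, up to finitely many. Then `|α - p / q| ≤ 1 / (L q²)`, and comparing `P_q(α)`
with the product `∏ |2 sin (π r p / q)| = q` over `1 ≤ r < q` gives, by concavity of the sine,
`P_q(α) ≪ (q² |α - p / q|) · exp (π (α - p / q) ∑ r cot (π r p / q))`.
The first factor is `O(1 / L)`. In terms of the inverse `p'` of `p` modulo `q`, the cotangent sum is
`q ∑ {k p' / q} cot (π k / q)`, and summation by parts reduces it to Birkhoff sums of the sawtooth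
function along the rotation by `p' / q`. Since `L` is a record, `α`, and hence `p' / q`, is badly
approximable with constant `O(L)` up to `q`; this makes the Birkhoff sums `O(L log)` and the
exponent `O(1)`. Thus `P_q(α) ≤ 1 / 2` when `L` is large. As `q α` is close to `p`, it follows that
`P_{n + q}(α) ≈ P_n(α) P_q(α) ≤ (3 / 4) P_n(α)`, which can be iterated. If infinitely many partial
quotients are at least `K`, then so are infinitely many records, whether or not they are bounded.
-/

open Finset Filter Real Topology

section Trigonometry

lemma sin_add_le_sin_mul_exp {x y : ℝ} (hx : x ∈ Set.Ioo 0 π) (hxy : x + y ∈ Set.Icc 0 π) :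
    sin (x + y) ≤ sin x * exp (y * cot x) := by
  have hsin : 0 < sin x := sin_pos_of_mem_Ioo hx
  have htangent : sin (x + y) ≤ sin x + y * cos x := by
    have hx' := Set.Ioo_subset_Icc_self hx
    have hconc := strictConcaveOn_sin_Icc.concaveOn
    have hder := hasDerivAt_sin x
    rcases lt_trichotomy y 0 with hy | rfl | hy
    · have h := hconc.le_slope_of_hasDerivAt hxy hx' (by linarith) hder
      rw [slope_def_field, le_div_iff₀ (by linarith)] at h
      linarith
    · simp
    · have h := hconc.slope_le_of_hasDerivAt hx' hxy (by linarith) hder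
      rw [slope_def_field, div_le_iff₀ (by linarith)] at h
      linarith
  calc sin (x + y) ≤ sin x * (y * cot x + 1) := by
        rw [cot_eq_cos_div_sin]
        field_simp
        linarith
    _ ≤ sin x * exp (y * cot x) := by gcongr; exact add_one_le_exp _

lemma cot_add_int_mul_pi (x : ℝ) (n : ℤ) : cot (x + n * π) = cot x := by
  rw [cot_eq_cos_div_sin, cot_eq_cos_div_sin, cos_add_int_mul_pi, sin_add_int_mul_pi,
    mul_div_mul_left _ _ (zpow_ne_zero n (by norm_num))]

lemma cot_pi_sub (x : ℝ) : cot (π - x) = -cot x := by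
  rw [cot_eq_cos_div_sin, cot_eq_cos_div_sin, cos_pi_sub, sin_pi_sub, neg_div]

lemma abs_sin_add_le_abs_sin_mul_exp {x y : ℝ} (n : ℤ)
    (hx : x ∈ Set.Ioo (n * π) ((n + 1) * π)) (hxy : x + y ∈ Set.Icc (n * π) ((n + 1) * π)) :
    |sin (x + y)| ≤ |sin x| * exp (y * cot x) := by
  obtain ⟨t, rfl⟩ : ∃ t, x = t + n * π := ⟨x - n * π, by ring⟩
  have ht : t ∈ Set.Ioo 0 π := ⟨by linarith [hx.1], by linarith [hx.2]⟩
  have hty : t + y ∈ Set.Icc 0 π := ⟨by linarith [hxy.1], by linarith [hxy.2]⟩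
  rw [add_right_comm, sin_add_int_mul_pi, sin_add_int_mul_pi, cot_add_int_mul_pi, abs_mul, abs_mul,
    abs_neg_one_zpow, one_mul, one_mul, abs_of_nonneg (sin_nonneg_of_mem_Icc hty),
    abs_of_pos (sin_pos_of_mem_Ioo ht)]
  exact sin_add_le_sin_mul_exp ht hty

end Trigonometry

section NearbyFraction

lemma fract_intCast_div_mem_Icc {q : ℕ} (hq : 0 < q) {z : ℤ} (hz : ¬(q : ℤ) ∣ z) :
    Int.fract ((z : ℝ) / q) ∈ Set.Icc (1 / (q : ℝ)) (1 - 1 / q) := by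
  have hq0 : (0 : ℝ) < q := by exact_mod_cast hq
  have hpos : 1 ≤ z % q := by
    have h0 := Int.emod_nonneg z (by omega : (q : ℤ) ≠ 0)
    have h1 : z % q ≠ 0 := mt Int.dvd_of_emod_eq_zero hz
    omega
  have hlt : z % q + 1 ≤ q := Int.emod_lt_of_pos z (by omega)
  have hfract : Int.fract ((z : ℝ) / q) = ((z % q : ℤ) : ℝ) / q := by
    exact_mod_cast Int.fract_div_intCast_eq_div_intCast_mod (k := ℝ) (m := z) (n := q)
  have hpos' : (1 : ℝ) ≤ (z % q : ℤ) := by exact_mod_cast hpos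
  have hlt' : ((z % q : ℤ) : ℝ) + 1 ≤ q := by exact_mod_cast hlt
  rw [hfract, Set.mem_Icc, one_sub_div hq0.ne', div_le_div_iff_of_pos_right hq0,
    div_le_div_iff_of_pos_right hq0]
  exact ⟨hpos', by linarith⟩

lemma natCast_not_dvd_mul_of_isCoprime {q r : ℕ} {p : ℤ} (hpq : IsCoprime p q) (hr : 1 ≤ r)
    (hrq : r < q) : ¬(q : ℤ) ∣ r * p := fun h => by
  have := Int.le_of_dvd (by omega) (hpq.symm.dvd_of_dvd_mul_right h)
  omega

lemma prod_abs_two_mul_sin_eq {q : ℕ} (hq : 0 < q) {p : ℤ} (hpq : IsCoprime p q) :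
    ∏ r ∈ Ico 1 q, |2 * sin (π * r * (p / q))| = q := by
  obtain ⟨n, rfl⟩ : ∃ n, q = n + 1 := ⟨q - 1, by omega⟩
  set ζ : ℂ := Complex.exp (2 * π * Complex.I / (n + 1 : ℕ)) ^ p with hζ_def
  have hζ : IsPrimitiveRoot ζ (n + 1) :=
    (Complex.isPrimitiveRoot_exp (n + 1) hq.ne').zpow_of_gcd_eq_one p
      (Int.isCoprime_iff_gcd_eq_one.1 hpq)
  have hfactor (k : ℕ) :
      |2 * sin (π * (1 + k : ℕ) * (p / (n + 1 : ℕ)))| = ‖1 - ζ ^ (k + 1)‖ := by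
    have hpow : ζ ^ (k + 1) = Complex.exp (Complex.I *
        ((2 * (π * (1 + k : ℕ) * (p / (n + 1 : ℕ))) : ℝ) : ℂ)) := by
      rw [hζ_def, ← Complex.exp_int_mul, ← Complex.exp_nat_mul]
      push_cast
      ring_nf
    rw [← norm_neg, neg_sub, hpow, Complex.norm_exp_I_mul_ofReal_sub_one, norm_eq_abs]
    congr 3
    ring
  rw [prod_Ico_eq_prod_range, Nat.add_sub_cancel, prod_congr rfl fun k _ => hfactor k,
    ← norm_prod, hζ.prod_one_sub_pow_eq_order, ← Nat.cast_add_one, Complex.norm_natCast]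

lemma abs_two_mul_sin_le {q : ℕ} {p : ℤ} (hpq : IsCoprime p q) {α : ℝ}
    (hα : |α - p / q| ≤ 1 / (q : ℝ) ^ 2) {r : ℕ} (hr : 1 ≤ r) (hrq : r < q) :
    |2 * sin (π * r * α)| ≤
      |2 * sin (π * r * (p / q))| * exp (π * (α - p / q) * (r * cot (π * (r * p / q)))) := by
  have hq0 : (0 : ℝ) < q := by exact_mod_cast (by omega : 0 < q)
  obtain ⟨hlow, hupp⟩ :=
    fract_intCast_div_mem_Icc (by omega) (natCast_not_dvd_mul_of_isCoprime hpq hr hrq)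
  have hfloor := Int.floor_add_fract (((r * p : ℤ) : ℝ) / q)
  have hshift : |r * (α - p / q)| ≤ 1 / q := by
    rw [abs_mul, Nat.abs_cast]
    calc r * |α - p / q| ≤ q * (1 / (q : ℝ) ^ 2) := by gcongr
      _ = 1 / q := by field_simp
  rw [abs_le] at hshift
  have hqinv : 0 < 1 / (q : ℝ) := by positivity
  push_cast at hfloor hlow hupp
  have hfrac : π * r * (p / q) = (r * p / q) * π := by ring
  have hα' : π * r * α = (r * p / q) * π + r * (α - p / q) * π := by ring
  have hexp : π * (α - p / q) * (r * cot (π * (r * p / q))) =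
      r * (α - p / q) * π * cot ((r * p / q) * π) := by ring_nf
  rw [hfrac, hα', hexp, abs_mul, abs_mul, mul_assoc |(2 : ℝ)|]
  gcongr
  refine abs_sin_add_le_abs_sin_mul_exp ⌊(r * p / q : ℝ)⌋ ⟨?_, ?_⟩ ⟨?_, ?_⟩
  · gcongr
    linarith
  · refine mul_lt_mul_of_pos_right ?_ pi_pos
    linarith
  all_goals
    rw [← add_mul]
    refine mul_le_mul_of_nonneg_right ?_ pi_pos.le
    linarith

lemma prod_abs_two_mul_sin_le {q : ℕ} (hq : 0 < q) {p : ℤ} (hpq : IsCoprime p q) {α : ℝ}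
    (hα : |α - p / q| ≤ 1 / (q : ℝ) ^ 2) :
    ∏ r ∈ Ico 1 q, |2 * sin (π * r * α)| ≤
      q * exp (π * (α - p / q) * ∑ r ∈ Ico 1 q, r * cot (π * (r * p / q))) := by
  calc ∏ r ∈ Ico 1 q, |2 * sin (π * r * α)|
      ≤ ∏ r ∈ Ico 1 q, |2 * sin (π * r * (p / q))| *
          exp (π * (α - p / q) * (r * cot (π * (r * p / q)))) := by
        refine prod_le_prod (fun _ _ => abs_nonneg _) fun r hr => ?_
        rw [mem_Ico] at hr
        exact abs_two_mul_sin_le hpq hα hr.1 hr.2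
    _ = q * exp (π * (α - p / q) * ∑ r ∈ Ico 1 q, r * cot (π * (r * p / q))) := by
        rw [prod_mul_distrib, prod_abs_two_mul_sin_eq hq hpq, ← exp_sum, mul_sum]

end NearbyFraction

section Sawtooth

lemma sum_range_add_mul_emod {d : ℕ} (hd : 0 < d) {e : ℤ} (hed : IsCoprime e d) (Y : ℤ)
    (φ : ℤ → ℝ) :
    ∑ j ∈ range d, φ ((Y + j * e) % d) = ∑ n ∈ range d, φ n := by
  have hnonneg (z : ℤ) : 0 ≤ z % d := Int.emod_nonneg z (by omega)
  have hlt (z : ℤ) : z % d < d := Int.emod_lt_of_pos z (by omega)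
  have hmaps : ∀ j ∈ range d, ((Y + j * e) % d).toNat ∈ range d := fun j _ => by
    have := hlt (Y + j * e)
    rw [mem_range]
    omega
  have hinj : Set.InjOn (fun j : ℕ => ((Y + j * e) % d).toNat) (range d) := by
    intro j hj k hk hjk
    rw [coe_range, Set.mem_Iio] at hj hk
    have hmod : (Y + j * e) % d = (Y + k * e) % d := by
      have := hnonneg (Y + j * e)
      have := hnonneg (Y + k * e)
      dsimp only at hjk
      omega
    have hdvd : (d : ℤ) ∣ (k - j) * e := by
      have := Int.ModEq.dvd hmod
      rwa [add_sub_add_left_eq_sub, ← sub_mul] at this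
    have := Int.eq_zero_of_abs_lt_dvd (hed.symm.dvd_of_dvd_mul_right hdvd)
      (by rw [abs_lt]; constructor <;> omega)
    omega
  refine sum_nbij _ hmaps hinj (surjOn_of_injOn_of_card_le _ hmaps hinj le_rfl) fun j _ => ?_
  rw [Int.toNat_of_nonneg (hnonneg _)]

/-- The Birkhoff sum of the sawtooth function `t ↦ {t} - 1/2` over `N` steps of the rotation by
`x` started at `y`. -/
noncomputable def sawtoothSum (x y : ℝ) (N : ℕ) : ℝ :=
  ∑ j ∈ range N, (Int.fract (j * x + y) - 1 / 2)

/-- The number `x` is badly approximable with constant `B` by fractions of denominator at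
most `N`. -/
def BadlyApproximableUpTo (x B : ℝ) (N : ℕ) : Prop :=
  ∀ j : ℕ, 1 ≤ j → j ≤ N → ∀ i : ℤ, 1 / (B * j) ≤ |j * x - i|

lemma sawtoothSum_add (x y : ℝ) (M N : ℕ) :
    sawtoothSum x y (M + N) = sawtoothSum x y M + sawtoothSum x (M * x + y) N := by
  simp only [sawtoothSum, sum_range_add, Nat.cast_add, add_mul, add_assoc, add_left_comm]

lemma sawtoothSum_intCast_div {d : ℕ} (hd : 0 < d) {e : ℤ} (hed : IsCoprime e d) (y : ℝ) :
    sawtoothSum (e / d) y d = Int.fract (d * y) - 1 / 2 := by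
  have hd0 : (0 : ℝ) < d := by exact_mod_cast hd
  have hfract (j : ℕ) : Int.fract (j * (e / d) + y) =
      (((⌊d * y⌋ + j * e) % d : ℤ) + Int.fract (d * y)) / d := by
    have hmod : ((⌊d * y⌋ + j * e) % d : ℤ) + (1 : ℝ) ≤ d := by
      exact_mod_cast Int.emod_lt_of_pos (⌊d * y⌋ + j * e) (by omega : (0 : ℤ) < d)
    have hmod0 : (0 : ℝ) ≤ ((⌊d * y⌋ + j * e) % d : ℤ) := by
      exact_mod_cast Int.emod_nonneg (⌊d * y⌋ + j * e) (by omega : (d : ℤ) ≠ 0)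
    have hdiv : ((⌊d * y⌋ + j * e) % d : ℤ) + d * (((⌊d * y⌋ + j * e) / d : ℤ) : ℝ) =
        ⌊d * y⌋ + j * e := by
      exact_mod_cast Int.emod_add_mul_ediv (⌊d * y⌋ + j * e) d
    have hy := Int.floor_add_fract (d * y)
    rw [Int.fract_eq_iff]
    refine ⟨div_nonneg (add_nonneg hmod0 (Int.fract_nonneg _)) hd0.le, ?_,
      (⌊d * y⌋ + j * e) / d, ?_⟩
    · rw [div_lt_one hd0]
      linarith [Int.fract_lt_one (d * y)]
    · field_simp
      linarith
  have hgauss : (∑ n ∈ range d, (n : ℝ)) * 2 = d * (d - 1) := by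
    have := congrArg (Nat.cast (R := ℝ)) (sum_range_id_mul_two d)
    rwa [Nat.cast_mul, Nat.cast_mul, Nat.cast_sum, Nat.cast_pred hd, Nat.cast_ofNat] at this
  simp only [sawtoothSum, hfract]
  rw [sum_range_add_mul_emod hd hed ⌊d * y⌋ fun n => ((n + Int.fract (d * y)) / d - 1 / 2 : ℝ),
    sum_sub_distrib, ← sum_div, sum_add_distrib]
  simp only [Int.cast_natCast, sum_const, card_range, nsmul_eq_mul]
  field_simp
  linarith

lemma fract_add_mem_Icc {t s ε : ℝ} (hs : |s| ≤ ε) :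
    Int.fract (t + s) ∈ Set.Icc (Int.fract (t + ε) - 2 * ε) (Int.fract (t - ε) + 2 * ε) := by
  rw [abs_le] at hs
  have hlow : (⌊t - ε⌋ : ℝ) ≤ ⌊t + s⌋ := by exact_mod_cast Int.floor_mono (by linarith)
  have hupp : (⌊t + s⌋ : ℝ) ≤ ⌊t + ε⌋ := by exact_mod_cast Int.floor_mono (by linarith)
  simp only [Int.fract, Set.mem_Icc]
  constructor <;> linarith

lemma abs_sawtoothSum_le_of_abs_sub_le {d : ℕ} (hd : 0 < d) {e : ℤ} (hed : IsCoprime e d) {x : ℝ}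
    (hx : |x - e / d| ≤ 1 / (d : ℝ) ^ 2) (y : ℝ) : |sawtoothSum x y d| ≤ 5 / 2 := by
  have : (0 : ℝ) < d := by exact_mod_cast hd
  have hterm : ∀ j ∈ range d, Int.fract (j * x + y) ∈
      Set.Icc (Int.fract (j * (e / d) + (y + 1 / d)) - 2 * (1 / d))
        (Int.fract (j * (e / d) + (y - 1 / d)) + 2 * (1 / d)) := by
    intro j hj
    have hjd : (j : ℝ) ≤ d := by exact_mod_cast (mem_range.1 hj).le
    have hshift : |j * (x - e / d)| ≤ 1 / d := by
      rw [abs_mul, Nat.abs_cast]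
      calc (j : ℝ) * |x - e / d| ≤ d * (1 / (d : ℝ) ^ 2) := by gcongr
        _ = 1 / d := by field_simp
    convert fract_add_mem_Icc (t := j * (e / d) + y) hshift using 2 <;> ring_nf
  have hmean : d * (2 * (1 / (d : ℝ))) = 2 := by field_simp
  have hlow : sawtoothSum (e / d) (y + 1 / d) d - 2 ≤ sawtoothSum x y d := by
    calc sawtoothSum (e / d) (y + 1 / d) d - 2
        = ∑ j ∈ range d, (Int.fract (j * (e / d) + (y + 1 / d)) - 2 * (1 / d) - 1 / 2) := by
          simp only [sawtoothSum, sum_sub_distrib, sum_const, card_range, nsmul_eq_mul, hmean]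
          ring
      _ ≤ sawtoothSum x y d := sum_le_sum fun j hj => by linarith [(hterm j hj).1]
  have hupp : sawtoothSum x y d ≤ sawtoothSum (e / d) (y - 1 / d) d + 2 := by
    calc sawtoothSum x y d
        ≤ ∑ j ∈ range d, (Int.fract (j * (e / d) + (y - 1 / d)) + 2 * (1 / d) - 1 / 2) :=
          sum_le_sum fun j hj => by linarith [(hterm j hj).2]
      _ = sawtoothSum (e / d) (y - 1 / d) d + 2 := by
          simp only [sawtoothSum, sum_sub_distrib, sum_add_distrib, sum_const, card_range,
            nsmul_eq_mul, hmean]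
          ring
  rw [sawtoothSum_intCast_div hd hed] at hlow hupp
  rw [abs_le]
  constructor
  · linarith [Int.fract_nonneg (d * (y + 1 / d))]
  · linarith [Int.fract_lt_one (d * (y - 1 / d))]

lemma abs_sawtoothSum_mul_add_le {d : ℕ} {x b : ℝ} (hb : ∀ y, |sawtoothSum x y d| ≤ b) {r : ℕ}
    {C : ℝ} (hC : ∀ y, |sawtoothSum x y r| ≤ C) (m : ℕ) (y : ℝ) :
    |sawtoothSum x y (d * m + r)| ≤ m * b + C := by
  induction m generalizing y with
  | zero => simpa using hC y
  | succ m ih =>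
    rw [show d * (m + 1) + r = d + (d * m + r) by ring, sawtoothSum_add]
    refine (abs_add_le _ _).trans ?_
    push_cast
    linarith [hb y, ih (d * x + y)]

lemma BadlyApproximableUpTo.mono {x B : ℝ} {M N : ℕ} (h : BadlyApproximableUpTo x B N)
    (hMN : M ≤ N) : BadlyApproximableUpTo x B M :=
  fun j hj hjM => h j hj (hjM.trans hMN)

lemma BadlyApproximableUpTo.exists_approx {x B : ℝ} (hB : 0 < B) {N : ℕ} (hN : 0 < N)
    (h : BadlyApproximableUpTo x B N) :
    ∃ (d : ℕ) (e : ℤ), 0 < d ∧ d ≤ N ∧ N ≤ B * d ∧ IsCoprime e d ∧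
      |x - e / d| ≤ 1 / (d : ℝ) ^ 2 := by
  obtain ⟨r, hr, hrN⟩ := exists_rat_abs_sub_le_and_den_le x hN
  have hd0 : (0 : ℝ) < r.den := by exact_mod_cast r.den_pos
  have hdN : (r.den : ℝ) ≤ N := by exact_mod_cast hrN
  rw [Rat.cast_def] at hr
  refine ⟨r.den, r.num, r.den_pos, hrN, ?_, Rat.isCoprime_num_den r, ?_⟩
  · have hclose : |r.den * x - r.num| ≤ 1 / (N + 1) := by
      rw [show r.den * x - r.num = r.den * (x - r.num / r.den) by field_simp, abs_mul, Nat.abs_cast]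
      calc (r.den : ℝ) * |x - r.num / r.den| ≤ r.den * (1 / ((N + 1) * r.den)) := by gcongr
        _ = 1 / (N + 1) := by field_simp
    have := (h r.den r.den_pos hrN r.num).trans hclose
    rw [one_div_le_one_div (by positivity) (by positivity)] at this
    linarith
  · refine hr.trans (one_div_le_one_div_of_le (by positivity) ?_)
    rw [sq]
    gcongr
    linarith

lemma BadlyApproximableUpTo.abs_sawtoothSum_le {x B : ℝ} (hB : 0 < B) {N : ℕ}
    (h : BadlyApproximableUpTo x B N) (y : ℝ) :
    |sawtoothSum x y N| ≤ 4 * B * (log N + 1) := by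
  induction N using Nat.strong_induction_on generalizing y with
  | _ N ih =>
    rcases Nat.eq_zero_or_pos N with rfl | hN
    · simpa [sawtoothSum] using hB.le
    obtain ⟨d, e, hd, hdN, hNd, hed, hx⟩ := h.exists_approx hB hN
    have hquot : ((N / d : ℕ) : ℝ) ≤ B :=
      Nat.cast_div_le.trans ((div_le_iff₀ (by exact_mod_cast hd)).2 hNd)
    have hlogN : 0 ≤ log N := log_natCast_nonneg N
    have hlog2 := log_two_gt_d9
    have hrem (y : ℝ) : |sawtoothSum x y (N % d)| ≤ 4 * B * (log N + 1) - 5 / 2 * B := by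
      rcases Nat.eq_zero_or_pos (N % d) with h0 | h0
      · rw [h0, sawtoothSum, range_zero, sum_empty, abs_zero]
        nlinarith
      · have hhalf : 2 * (N % d) ≤ N := by
          have := Nat.mod_lt N hd
          have := Nat.div_add_mod N d
          have : 1 ≤ N / d := Nat.div_pos hdN hd
          nlinarith
        have hlog : log 2 + log (N % d : ℕ) ≤ log N := by
          rw [← log_mul two_ne_zero (by positivity)]
          exact log_le_log (by positivity) (by exact_mod_cast hhalf)
        have := ih (N % d) (by omega) (h.mono (Nat.mod_le _ _)) y
        nlinarith
    have := abs_sawtoothSum_mul_add_le (abs_sawtoothSum_le_of_abs_sub_le hd hed hx) hrem (N / d) y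
    rw [Nat.div_add_mod] at this
    linarith

end Sawtooth

section CotangentSums

lemma cot_pi_mul_sub_div {q k : ℕ} (hkq : k ≤ q) (hq : 0 < q) :
    cot (π * (q - k : ℕ) / q) = -cot (π * k / q) := by
  have hq0 : (q : ℝ) ≠ 0 := by exact_mod_cast hq.ne'
  rw [← cot_pi_sub, Nat.cast_sub hkq]
  congr 1
  field_simp

lemma sum_cot_eq_zero (q : ℕ) : ∑ k ∈ Ico 1 q, cot (π * k / q) = 0 := by
  have hreflect := sum_Ico_reflect (fun k => cot (π * k / q)) 1 q.le_succ
  have hneg : ∑ k ∈ Ico 1 q, cot (π * (q - k : ℕ) / q) = -∑ k ∈ Ico 1 q, cot (π * k / q) := by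
    rw [← sum_neg_distrib]
    refine sum_congr rfl fun k hk => ?_
    rw [mem_Ico] at hk
    exact cot_pi_mul_sub_div hk.2.le (by omega)
  rw [hneg, Nat.add_sub_cancel_left, Nat.add_sub_cancel] at hreflect
  linarith

lemma sum_mul_cot_eq {q : ℕ} (hq : 0 < q) {p p' : ℤ} (hp : (q : ℤ) ∣ p * p' - 1) :
    ∑ r ∈ Ico 1 q, (r : ℝ) * cot (π * (r * p / q)) =
      q * ∑ k ∈ Ico 1 q, Int.fract (k * (p' / q : ℝ)) * cot (π * k / q) := by
  have hq0 : (q : ℝ) ≠ 0 := by exact_mod_cast hq.ne'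
  have hcop : IsCoprime p' (q : ℤ) := by
    obtain ⟨t, ht⟩ := hp
    exact ⟨p, -t, by linarith⟩
  have hperm := sum_range_add_mul_emod hq hcop 0 fun n => (n : ℝ) * cot (π * (n * p / q))
  rw [range_eq_Ico, sum_eq_sum_Ico_succ_bot hq, sum_eq_sum_Ico_succ_bot hq] at hperm
  simp only [Nat.cast_zero, zero_mul, add_zero, Int.zero_emod, Int.cast_zero, zero_add,
    Int.cast_natCast] at hperm
  rw [← hperm, mul_sum]
  refine sum_congr rfl fun k _ => ?_
  obtain ⟨z, hz⟩ : (q : ℤ) ∣ k * p' % q * p - k := by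
    have hmod : (q : ℤ) ∣ k * p' % q - k * p' := (Int.mod_modEq _ _).symm.dvd
    rw [show k * p' % q * p - k = (k * p' % q - k * p') * p + k * (p * p' - 1) by ring]
    exact dvd_add (hmod.mul_right p) (hp.mul_left k)
  have hz' : ((k * p' % q : ℤ) : ℝ) * p - k = q * z := by exact_mod_cast hz
  have hcot : cot (π * ((k * p' % q : ℤ) * p / q)) = cot (π * k / q) := by
    rw [← cot_add_int_mul_pi (π * k / q) z]
    congr 1
    field_simp
    linarith
  have hfract : Int.fract (k * (p' / q : ℝ)) = (k * p' % q : ℤ) / q := by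
    rw [← mul_div_assoc]
    exact_mod_cast Int.fract_div_intCast_eq_div_intCast_mod (k := ℝ) (m := k * p') (n := q)
  rw [hcot, hfract]
  field_simp

lemma sum_Ico_eq_two_mul_of_symm {q : ℕ} {f : ℕ → ℝ}
    (hsymm : ∀ k, 1 ≤ k → k < q → f (q - k) = f k) (hmid : ∀ k, 2 * k = q → f k = 0) :
    ∑ k ∈ Ico 1 q, f k = 2 * ∑ k ∈ range ((q - 1) / 2), f (k + 1) := by
  rcases Nat.eq_zero_or_pos q with rfl | hq
  · simp
  set h := (q - 1) / 2
  have hleft : ∑ k ∈ range h, f (k + 1) = ∑ k ∈ Ico 1 (h + 1), f k := by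
    rw [sum_Ico_eq_sum_range, Nat.add_sub_cancel]
    simp only [add_comm]
  have hright : ∑ k ∈ Ico (q - h) q, f k = ∑ k ∈ Ico 1 (h + 1), f k := by
    have hreflect := sum_Ico_reflect f 1 (by omega : h + 1 ≤ q + 1)
    rw [Nat.add_sub_add_right, Nat.add_sub_cancel] at hreflect
    rw [← hreflect]
    refine sum_congr rfl fun k hk => ?_
    rw [mem_Ico] at hk
    exact hsymm k hk.1 (by omega)
  have hmiddle : ∑ k ∈ Ico (h + 1) (q - h), f k = 0 :=
    sum_eq_zero fun k hk => hmid k (by rw [mem_Ico] at hk; omega)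
  rw [← sum_Ico_consecutive f (by omega : 1 ≤ h + 1) (by omega : h + 1 ≤ q),
    ← sum_Ico_consecutive f (by omega : h + 1 ≤ q - h) (Nat.sub_le q h), hmiddle, hright, hleft]
  ring

lemma sum_fract_mul_cot_eq {q : ℕ} {p : ℤ} (hcop : IsCoprime p q) :
    ∑ k ∈ Ico 1 q, Int.fract (k * (p / q : ℝ)) * cot (π * k / q) =
      2 * ∑ k ∈ range ((q - 1) / 2),
        (Int.fract (k * (p / q : ℝ) + p / q) - 1 / 2) * cot (π * (k + 1 : ℕ) / q) := by
  -- Subtracting `1 / 2` is free as the cotangents sum to `0`; the sawtooth and the cotangent are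
  -- then both odd about `q / 2`.
  set f : ℕ → ℝ := fun k => (Int.fract (k * (p / q : ℝ)) - 1 / 2) * cot (π * k / q) with f_def
  have hcentre : ∑ k ∈ Ico 1 q, Int.fract (k * (p / q : ℝ)) * cot (π * k / q) =
      ∑ k ∈ Ico 1 q, f k := by
    simp only [f_def, sub_mul, sum_sub_distrib, ← mul_sum, sum_cot_eq_zero, mul_zero, sub_zero]
  have hsymm : ∀ k, 1 ≤ k → k < q → f (q - k) = f k := by
    intro k hk hkq
    have hq0 : (q : ℝ) ≠ 0 := by exact_mod_cast (by omega : q ≠ 0)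
    have hfract_pos : 0 < Int.fract (k * (p / q : ℝ)) := by
      have h := (fract_intCast_div_mem_Icc (by omega)
        (natCast_not_dvd_mul_of_isCoprime hcop hk hkq)).1
      rw [← mul_div_assoc]
      push_cast at h
      exact lt_of_lt_of_le (by positivity) h
    have hfract : Int.fract ((q - k : ℕ) * (p / q : ℝ)) = 1 - Int.fract (k * (p / q : ℝ)) := by
      have hreflect : (q - k : ℕ) * (p / q : ℝ) = p + -(k * (p / q)) := by
        rw [Nat.cast_sub hkq.le]
        field_simp
        ring
      rw [hreflect, Int.fract_intCast_add, Int.fract_neg hfract_pos.ne']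
    simp only [f_def, hfract, cot_pi_mul_sub_div hkq.le (by omega)]
    ring
  have hmid : ∀ k, 2 * k = q → f k = 0 := by
    intro k hk
    rcases Nat.eq_zero_or_pos q with rfl | hq
    · simp [f_def, cot_eq_cos_div_sin]
    have hcot := cot_pi_mul_sub_div (by omega : k ≤ q) hq
    rw [show q - k = k by omega, self_eq_neg] at hcot
    simp only [f_def, hcot, mul_zero]
  rw [hcentre, sum_Ico_eq_two_mul_of_symm hsymm hmid]
  simp only [f_def, Nat.cast_add, Nat.cast_one, add_mul, one_mul]

lemma sum_range_mul_by_parts (s c : ℕ → ℝ) {h : ℕ} (hh : 1 ≤ h) :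
    ∑ k ∈ range h, s k * c (k + 1) =
      ∑ k ∈ Ico 1 h, (∑ j ∈ range k, s j) * (c k - c (k + 1)) + (∑ j ∈ range h, s j) * c h := by
  induction h, hh using Nat.le_induction with
  | base => simp
  | succ h hh ih =>
    rw [sum_range_succ, ih, sum_Ico_succ_top hh, sum_range_succ _ h]
    ring

lemma abs_cot_sub_cot_le {x y : ℝ} (hx : 0 < x) (hxy : x ≤ y) (hy : y ≤ π / 2) :
    |cot x - cot y| ≤ π ^ 2 / 4 * ((y - x) / (x * y)) := by
  have hy0 : 0 < y := hx.trans_le hxy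
  have hx_le_sin := mul_le_sin hx.le (hxy.trans hy)
  have hy_le_sin := mul_le_sin hy0.le hy
  have hsinx : 0 < sin x := lt_of_lt_of_le (by positivity) hx_le_sin
  have hsiny : 0 < sin y := lt_of_lt_of_le (by positivity) hy_le_sin
  have hdiff : cot x - cot y = sin (y - x) / (sin x * sin y) := by
    rw [cot_eq_cos_div_sin, cot_eq_cos_div_sin, sin_sub]
    field_simp
  rw [hdiff, abs_div, abs_of_pos (mul_pos hsinx hsiny)]
  calc |sin (y - x)| / (sin x * sin y) ≤ (y - x) / ((2 / π * x) * (2 / π * y)) := by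
        gcongr
        exact abs_sin_le_abs.trans_eq (abs_of_nonneg (sub_nonneg.2 hxy))
    _ = π ^ 2 / 4 * ((y - x) / (x * y)) := by
        field_simp
        norm_num

lemma abs_cot_sub_cot_succ_le {q k : ℕ} (hk : 1 ≤ k) (hkq : 2 * (k + 1) ≤ q) :
    |cot (π * k / q) - cot (π * (k + 1 : ℕ) / q)| ≤ q / (k * (k + 1)) := by
  have hq0 : (0 : ℝ) < q := by exact_mod_cast (by omega : 0 < q)
  have : (0 : ℝ) < k := by exact_mod_cast hk
  have hkq' : 2 * ((k : ℝ) + 1) ≤ q := by exact_mod_cast hkq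
  refine (abs_cot_sub_cot_le (by positivity) (by gcongr; simp) ?_).trans ?_
  · rw [div_le_div_iff₀ hq0 two_pos]
    push_cast
    nlinarith [pi_pos]
  · calc π ^ 2 / 4 * ((π * (k + 1 : ℕ) / q - π * k / q) / (π * k / q * (π * (k + 1 : ℕ) / q)))
        = π / 4 * (q / (k * (k + 1))) := by push_cast; field_simp; ring
      _ ≤ 1 * (q / (k * (k + 1))) := by gcongr; linarith [pi_le_four]
      _ = q / (k * (k + 1)) := one_mul _

lemma abs_cot_le {q k : ℕ} (hk : 1 ≤ k) (hkq : 2 * k ≤ q) : |cot (π * k / q)| ≤ q / k := by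
  have hq0 : (0 : ℝ) < q := by exact_mod_cast (by omega : 0 < q)
  have : (0 : ℝ) < k := by exact_mod_cast hk
  have hkq' : 2 * (k : ℝ) ≤ q := by exact_mod_cast hkq
  have hle : π * k / q ≤ π / 2 := by
    rw [div_le_div_iff₀ hq0 two_pos]
    nlinarith [pi_pos]
  have hcot := abs_cot_sub_cot_le (by positivity) hle le_rfl
  rw [cot_eq_cos_div_sin (π / 2), cos_pi_div_two, zero_div, sub_zero] at hcot
  calc |cot (π * k / q)| ≤ π ^ 2 / 4 * ((π / 2 - π * k / q) / (π * k / q * (π / 2))) := hcot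
    _ ≤ π ^ 2 / 4 * (π / 2 / (π * k / q * (π / 2))) := by
        gcongr
        exact sub_le_self _ (by positivity)
    _ = π / 4 * (q / k) := by field_simp
    _ ≤ 1 * (q / k) := by gcongr; linarith [pi_le_four]
    _ = q / k := one_mul _

lemma abs_sum_fract_mul_cot_le_sawtoothSum {q : ℕ} (hq : 3 ≤ q) {p : ℤ} (hcop : IsCoprime p q) :
    |∑ k ∈ Ico 1 q, Int.fract (k * (p / q : ℝ)) * cot (π * k / q)| ≤
      2 * q * (∑ k ∈ Ico 1 ((q - 1) / 2), |sawtoothSum (p / q) (p / q) k| / (k * (k + 1)) +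
        |sawtoothSum (p / q) (p / q) ((q - 1) / 2)| / ((q - 1) / 2 : ℕ)) := by
  set h := (q - 1) / 2
  rw [sum_fract_mul_cot_eq hcop, abs_mul, abs_two, mul_assoc,
    sum_range_mul_by_parts (fun k => Int.fract (k * (p / q : ℝ) + p / q) - 1 / 2)
      (fun k => cot (π * k / q)) (by omega : 1 ≤ h), mul_add, mul_sum]
  gcongr
  refine (abs_add_le _ _).trans (add_le_add ((abs_sum_le_sum_abs _ _).trans ?_) ?_)
  · refine sum_le_sum fun k hk => ?_
    rw [mem_Ico] at hk
    rw [abs_mul, mul_div_left_comm]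
    exact mul_le_mul_of_nonneg_left (abs_cot_sub_cot_succ_le hk.1 (by omega)) (abs_nonneg _)
  · rw [abs_mul, mul_div_left_comm]
    exact mul_le_mul_of_nonneg_left (abs_cot_le (by omega) (by omega)) (abs_nonneg _)

lemma sum_Ico_log_div_add_le {T h : ℕ} (hT : 1 ≤ T) (hTh : T ≤ h) :
    ∑ k ∈ Ico T h, (log k + 1) / (k * (k + 1)) + (log h + 2) / h ≤ (log T + 2) / T := by
  induction h, hTh using Nat.le_induction with
  | base => simp
  | succ h hTh ih =>
    have hh0 : (0 : ℝ) < h := by exact_mod_cast hT.trans hTh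
    have hlog : log ((h + 1 : ℕ) : ℝ) ≤ log h + 1 / h := by
      have hsplit : ((h + 1 : ℕ) : ℝ) = h * (1 + 1 / h) := by
        push_cast
        field_simp
      rw [hsplit, log_mul hh0.ne' (by positivity)]
      linarith [log_le_sub_one_of_pos (by positivity : (0 : ℝ) < 1 + 1 / h)]
    have hstep : (log h + 1) / (h * (h + 1)) + (log (h + 1 : ℕ) + 2) / (h + 1 : ℕ) ≤
        (log h + 2) / h := by
      calc (log h + 1) / (h * (h + 1)) + (log (h + 1 : ℕ) + 2) / (h + 1 : ℕ)
          ≤ (log h + 1) / (h * (h + 1)) + (log h + 1 / h + 2) / (h + 1 : ℕ) := by gcongr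
        _ = (log h + 2) / h := by
            push_cast
            field_simp
            ring
    rw [sum_Ico_succ_top hTh]
    linarith

lemma sum_abs_div_add_abs_div_le {D : ℕ → ℝ} {A C : ℝ} (hA : 0 ≤ A) (hC : 0 ≤ C) {T h : ℕ}
    (hT : 1 ≤ T) (hTh : T ≤ h) (hCT : C * ((log T + 2) / T) ≤ 1)
    (hshort : ∀ k < T, |D k| ≤ A * (log k + 1)) (hlong : ∀ k ≤ h, |D k| ≤ (A + C) * (log k + 1)) :
    ∑ k ∈ Ico 1 h, |D k| / (k * (k + 1)) + |D h| / h ≤ 2 * A + 1 := by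
  set w : ℕ → ℝ := fun k => (log k + 1) / (k * (k + 1))
  have hsum_short : ∑ k ∈ Ico 1 T, |D k| / (k * (k + 1)) ≤ A * ∑ k ∈ Ico 1 T, w k := by
    rw [mul_sum]
    refine sum_le_sum fun k hk => ?_
    rw [← mul_div_assoc]
    gcongr
    exact hshort k (mem_Ico.1 hk).2
  have hsum_long : ∑ k ∈ Ico T h, |D k| / (k * (k + 1)) ≤ (A + C) * ∑ k ∈ Ico T h, w k := by
    rw [mul_sum]
    refine sum_le_sum fun k hk => ?_
    rw [← mul_div_assoc]
    gcongr
    exact hlong k (mem_Ico.1 hk).2.le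
  have hlast : |D h| / h ≤ (A + C) * ((log h + 2) / h) := by
    rw [← mul_div_assoc]
    gcongr
    exact (hlong h le_rfl).trans (by gcongr; norm_num)
  have htail_one := mul_le_mul_of_nonneg_left (sum_Ico_log_div_add_le le_rfl (hT.trans hTh)) hA
  have htail_T := mul_le_mul_of_nonneg_left (sum_Ico_log_div_add_le hT hTh) hC
  rw [← sum_Ico_consecutive w hT hTh, Nat.cast_one, log_one, zero_add, div_one] at htail_one
  rw [← sum_Ico_consecutive _ hT hTh]
  linarith

lemma BadlyApproximableUpTo.abs_sum_fract_mul_cot_le {q : ℕ} {p : ℤ} (hcop : IsCoprime p q)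
    {B₁ B₂ : ℝ} (hB₁ : 0 < B₁) (hB₂ : 0 < B₂) {T : ℕ} (hT : 1 ≤ T) (hTq : 2 * T < q)
    (hB₂T : 4 * B₂ * ((log T + 2) / T) ≤ 1) (hshort : BadlyApproximableUpTo (p / q) B₁ T)
    (hlong : BadlyApproximableUpTo (p / q) (B₁ + B₂) (q - 1)) :
    |∑ k ∈ Ico 1 q, Int.fract (k * (p / q : ℝ)) * cot (π * k / q)| ≤ q * (16 * B₁ + 2) := by
  have hsum := sum_abs_div_add_abs_div_le (D := sawtoothSum (p / q) (p / q)) (h := (q - 1) / 2)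
    (by positivity : 0 ≤ 4 * B₁) (by positivity) hT (by omega) hB₂T
    (fun k hk => (hshort.mono hk.le).abs_sawtoothSum_le hB₁ _) fun k hk => by
      rw [← mul_add]
      exact (hlong.mono (show k ≤ q - 1 by omega)).abs_sawtoothSum_le (add_pos hB₁ hB₂) _
  calc _ ≤ _ := abs_sum_fract_mul_cot_le_sawtoothSum (by omega) hcop
    _ ≤ 2 * q * (2 * (4 * B₁) + 1) := by gcongr
    _ = q * (16 * B₁ + 2) := by ring

end CotangentSums

section SmallProducts

/- If `j p' ≡ ± m (mod q)`, then `m p ≡ ± j (mod q)`, so that a good approximation to `p' / q` with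
denominator `j` turns into a good approximation to `α ≈ p / q` with denominator `m`. -/
lemma exists_abs_mul_inv_sub_eq {q : ℕ} {p p' : ℤ} (hp : (q : ℤ) ∣ p * p' - 1) {α : ℝ}
    (hα : |α - p / q| ≤ 1 / (q : ℝ) ^ 2) {j : ℕ} (hj : 1 ≤ j) (hjq : j < q) (i : ℤ) :
    ∃ m : ℕ, 1 ≤ m ∧ |j * (p' / q : ℝ) - i| = m / q ∧
      (m ≤ q → ∃ k : ℤ, |m * α - k| ≤ 2 * j / q) := by
  have hq0 : (0 : ℝ) < q := by exact_mod_cast (by omega : 0 < q)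
  set z : ℤ := j * p' - i * q with z_def
  have habs : (z.natAbs : ℝ) = |(z : ℝ)| := by rw [Nat.cast_natAbs, Int.cast_abs]
  obtain ⟨t, ht⟩ : ∃ t : ℤ, z * p = j + q * t := by
    obtain ⟨u, hu⟩ := hp
    refine ⟨j * u - i * p, ?_⟩
    rw [z_def]
    linear_combination (j : ℤ) * hu
  have hz0 : z ≠ 0 := fun h0 => by
    have hdvd : (q : ℤ) ∣ j := ⟨-t, by rw [h0] at ht; linarith⟩
    have := Int.le_of_dvd (by omega) hdvd
    omega
  refine ⟨z.natAbs, Int.natAbs_pos.2 hz0, ?_, fun hzq => ?_⟩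
  · have hz : j * (p' / q : ℝ) - i = z / q := by
      rw [z_def]
      push_cast
      field_simp
    rw [hz, abs_div, Nat.abs_cast, habs]
  · have hdist : |z * α - t| ≤ 2 * j / q := by
      have ht' : (z : ℝ) * p = j + q * t := by exact_mod_cast ht
      have hsplit : z * α - t = z * (α - p / q) + j / q := by
        field_simp
        linarith
      have hzq' : |(z : ℝ)| ≤ q := by
        rw [← habs]
        exact_mod_cast hzq
      have hj1 : (1 : ℝ) ≤ j := by exact_mod_cast hj
      calc |z * α - t| ≤ |(z : ℝ)| * |α - p / q| + j / q := by
            rw [hsplit]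
            refine (abs_add_le _ _).trans_eq ?_
            rw [abs_mul, abs_of_nonneg (by positivity : (0 : ℝ) ≤ j / q)]
        _ ≤ q * (1 / (q : ℝ) ^ 2) + j / q := by gcongr
        _ = (1 + j) / q := by field_simp
        _ ≤ 2 * j / q := by gcongr; linarith
    rcases abs_choice (z : ℝ) with hz | hz
    · exact ⟨t, by rwa [habs, hz]⟩
    · refine ⟨-t, ?_⟩
      rwa [habs, hz, ← abs_neg, Int.cast_neg, show -(-z * α - -t) = z * α - t by ring]

lemma le_abs_mul_inv_sub {q : ℕ} {p p' : ℤ} (hp : (q : ℤ) ∣ p * p' - 1) {α : ℝ}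
    (hα : |α - p / q| ≤ 1 / (q : ℝ) ^ 2) {B c : ℝ} (hB : 1 ≤ B)
    (happrox : ∀ m : ℕ, 1 ≤ m → m < q → ∀ k : ℤ, min c (1 / (B * m)) ≤ |m * α - k|)
    {j : ℕ} (hj : 1 ≤ j) (hjq : j < q) (i : ℤ) :
    c * q ≤ 2 * j ∧ c / (2 * j) ≤ |j * (p' / q : ℝ) - i| ∨
      1 / (2 * B * j) ≤ |j * (p' / q : ℝ) - i| := by
  have hq0 : (0 : ℝ) < q := by exact_mod_cast (by omega : 0 < q)
  have hj1 : (1 : ℝ) ≤ j := by exact_mod_cast hj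
  obtain ⟨m, hm, hmeq, hmk⟩ := exists_abs_mul_inv_sub_eq hp hα hj hjq i
  have hm1 : (1 : ℝ) ≤ m := by exact_mod_cast hm
  rw [hmeq]
  rcases le_or_gt q m with hqm | hmq
  · have hqm' : (q : ℝ) ≤ m := by exact_mod_cast hqm
    have hBj : 1 ≤ 2 * B * j := by nlinarith
    right
    rw [div_le_div_iff₀ (by positivity) hq0, one_mul]
    exact hqm'.trans (le_mul_of_one_le_right (by positivity) hBj)
  · obtain ⟨k, hk⟩ := hmk hmq.le
    rcases min_le_iff.1 (happrox m hm hmq k) with hc | hBm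
    · have hcq : c * q ≤ 2 * j := (le_div_iff₀ hq0).1 (hc.trans hk)
      refine .inl ⟨hcq, ?_⟩
      rw [div_le_div_iff₀ (by positivity) hq0]
      nlinarith
    · right
      have := hBm.trans hk
      rw [div_le_div_iff₀ (by positivity) hq0] at this ⊢
      linarith

lemma badlyApproximableUpTo_inv {q : ℕ} {p p' : ℤ} (hp : (q : ℤ) ∣ p * p' - 1) {α : ℝ}
    (hα : |α - p / q| ≤ 1 / (q : ℝ) ^ 2) {B c : ℝ} (hB : 1 ≤ B)
    (happrox : ∀ m : ℕ, 1 ≤ m → m < q → ∀ k : ℤ, min c (1 / (B * m)) ≤ |m * α - k|)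
    {T : ℕ} (hT : T < q) (hcT : 2 * T < c * q) : BadlyApproximableUpTo (p' / q) (2 * B) T := by
  intro j hj hjT i
  refine (le_abs_mul_inv_sub hp hα hB happrox hj (by omega) i).resolve_left fun h => ?_
  have hjT' : (j : ℝ) ≤ T := by exact_mod_cast hjT
  linarith [h.1]

lemma badlyApproximableUpTo_inv_pred {q : ℕ} (hq : 0 < q) {p p' : ℤ} (hp : (q : ℤ) ∣ p * p' - 1)
    {α : ℝ} (hα : |α - p / q| ≤ 1 / (q : ℝ) ^ 2) {B c : ℝ} (hB : 1 ≤ B) (hc : 0 < c)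
    (happrox : ∀ m : ℕ, 1 ≤ m → m < q → ∀ k : ℤ, min c (1 / (B * m)) ≤ |m * α - k|) :
    BadlyApproximableUpTo (p' / q) (2 * B + 2 / c) (q - 1) := by
  intro j hj hjq i
  have : (0 : ℝ) < j := by exact_mod_cast hj
  rcases le_abs_mul_inv_sub hp hα hB happrox hj (by omega) i with h | h
  · calc 1 / ((2 * B + 2 / c) * j) ≤ 1 / (2 / c * j) := by gcongr; linarith
      _ = c / (2 * j) := by field_simp
      _ ≤ _ := h.2
  · refine le_trans ?_ h
    gcongr
    exact le_add_of_nonneg_right (by positivity)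

lemma exists_mul_log_add_two_div_le_one (C : ℝ) :
    ∃ T : ℕ, 1 ≤ T ∧ C * ((log T + 2) / T) ≤ 1 := by
  have hlog : Tendsto (fun x : ℝ => log x / x) atTop (𝓝 0) :=
    isLittleO_log_id_atTop.tendsto_div_nhds_zero
  have htendsto : Tendsto (fun x : ℝ => C * ((log x + 2) / x)) atTop (𝓝 0) := by
    have htwo : Tendsto (fun x : ℝ => 2 / x) atTop (𝓝 0) :=
      tendsto_const_nhds.div_atTop tendsto_id
    simpa only [add_div, add_zero, mul_zero] using (hlog.add htwo).const_mul C
  exact ((eventually_ge_atTop 1).and ((htendsto.comp tendsto_natCast_atTop_atTop).eventually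
    (ge_mem_nhds one_pos))).exists

lemma abs_sin_pi_mul_le {q : ℕ} (hq : 0 < q) (p : ℤ) (α : ℝ) :
    |sin (π * q * α)| ≤ π * (q * |α - p / q|) := by
  have hq0 : (q : ℝ) ≠ 0 := by exact_mod_cast hq.ne'
  have hshift : π * q * α = π * (q * (α - p / q)) + p * π := by
    field_simp
    ring
  rw [hshift, sin_add_int_mul_pi, abs_mul, abs_neg_one_zpow, one_mul]
  refine abs_sin_le_abs.trans_eq ?_
  rw [abs_mul, abs_mul, abs_of_pos pi_pos, Nat.abs_cast]

lemma sudlerProduct_le_mul_exp {q : ℕ} (hq : 0 < q) {p p' : ℤ} (hp : (q : ℤ) ∣ p * p' - 1) {α : ℝ}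
    (hα : |α - p / q| ≤ 1 / (q : ℝ) ^ 2) :
    sudlerProduct q α ≤ 8 * (q ^ 2 * |α - p / q|) * exp (4 * (q * |α - p / q| *
      |∑ k ∈ Ico 1 q, Int.fract (k * (p' / q : ℝ)) * cot (π * k / q)|)) := by
  set S := ∑ k ∈ Ico 1 q, Int.fract (k * (p' / q : ℝ)) * cot (π * k / q)
  have hcop : IsCoprime p q := by
    obtain ⟨t, ht⟩ := hp
    exact ⟨p', -t, by linarith⟩
  have hprod := prod_abs_two_mul_sin_le hq hcop hα
  rw [sum_mul_cot_eq hq hp] at hprod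
  have hexp : π * (α - p / q) * (q * S) ≤ 4 * (q * |α - p / q| * |S|) := by
    calc π * (α - p / q) * (q * S) ≤ |π * (α - p / q) * (q * S)| := le_abs_self _
      _ = π * (q * |α - p / q| * |S|) := by
        rw [abs_mul, abs_mul, abs_mul, abs_of_pos pi_pos, Nat.abs_cast]
        ring
      _ ≤ 4 * (q * |α - p / q| * |S|) := by gcongr; exact pi_le_four
  have hlast : |2 * sin (π * q * α)| ≤ 8 * (q * |α - p / q|) := by
    calc |2 * sin (π * q * α)| ≤ 2 * (π * (q * |α - p / q|)) := by
          rw [abs_mul, abs_two]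
          gcongr
          exact abs_sin_pi_mul_le hq p α
      _ ≤ 2 * (4 * (q * |α - p / q|)) := by gcongr; exact pi_le_four
      _ = 8 * (q * |α - p / q|) := by ring
  rw [sudlerProduct, ← Ico_succ_right_eq_Icc, Order.succ_eq_add_one, prod_Ico_succ_top hq]
  calc _ ≤ q * exp (4 * (q * |α - p / q| * |S|)) * (8 * (q * |α - p / q|)) := by
        gcongr
        exact hprod.trans (by gcongr)
    _ = _ := by ring

lemma exists_forall_sudlerProduct_le_half {c : ℝ} (hc : 0 < c) :
    ∃ Q : ℕ, ∀ L : ℝ, exp 150 ≤ L → ∀ q : ℕ, Q ≤ q → ∀ (p : ℤ) (α : ℝ), IsCoprime p q →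
      |α - p / q| ≤ 1 / (L * (q : ℝ) ^ 2) →
      (∀ m : ℕ, 1 ≤ m → m < q → ∀ k : ℤ, min c (1 / ((L + 2) * m)) ≤ |m * α - k|) →
      sudlerProduct q α ≤ 1 / 2 := by
  -- Up to `T` the inverse `p' / q` is badly approximable with constant `2 (L + 2)`; beyond `T` only
  -- with the extra `2 / c`, whose contribution to the cotangent sum is a tail made small by `T`.
  obtain ⟨T, hT, hCT⟩ := exists_mul_log_add_two_div_le_one (4 * (2 / c))
  obtain ⟨Q, hQ⟩ := exists_nat_gt (2 * T / c)
  refine ⟨max Q (2 * T + 1), fun L hL q hqQ p α hcop hα happrox => ?_⟩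
  have hL1 : 1 ≤ L := (one_le_exp (by norm_num)).trans hL
  have hL16 : 16 * exp 132 ≤ L := by
    calc 16 * exp 132 ≤ exp 18 * exp 132 := by gcongr; linarith [add_one_le_exp (18 : ℝ)]
      _ = exp 150 := by rw [← exp_add]; norm_num
      _ ≤ L := hL
  obtain ⟨hQq, hTq⟩ := max_le_iff.1 hqQ
  have hq : 0 < q := by omega
  have : (0 : ℝ) < q := by exact_mod_cast hq
  have hcT : 2 * T < c * q := by
    rw [← div_lt_iff₀' hc]
    exact hQ.trans_le (by exact_mod_cast hQq)
  have hα1 : |α - p / q| ≤ 1 / (q : ℝ) ^ 2 :=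
    hα.trans (by gcongr; exact le_mul_of_one_le_left (by positivity) hL1)
  obtain ⟨p', t, ht⟩ := hcop
  have hp : (q : ℤ) ∣ p * p' - 1 := ⟨-t, by linarith⟩
  have hS := BadlyApproximableUpTo.abs_sum_fract_mul_cot_le (p := p') ⟨p, t, by linarith⟩
    (by positivity) (by positivity) hT hTq hCT
    (badlyApproximableUpTo_inv hp hα1 (by linarith) happrox (by omega) hcT)
    (badlyApproximableUpTo_inv_pred hq hp hα1 (by linarith) hc happrox)
  calc sudlerProduct q α ≤ _ := sudlerProduct_le_mul_exp hq hp hα1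
    _ ≤ 8 * (q ^ 2 * (1 / (L * q ^ 2))) *
        exp (4 * (q * (1 / (L * q ^ 2)) * (q * (16 * (2 * (L + 2)) + 2)))) := by gcongr
    _ = 8 / L * exp (128 + 264 / L) := by
        congr 2 <;> field_simp
        ring
    _ ≤ 8 / L * exp 132 := by
        gcongr
        have : 264 / L ≤ 4 := by
          rw [div_le_iff₀ (by linarith)]
          linarith [add_one_le_exp (150 : ℝ)]
        linarith
    _ ≤ 1 / 2 := by
        rw [div_mul_eq_mul_div, div_le_div_iff₀ (by linarith) two_pos]
        linarith

end SmallProducts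

section Liminf

lemma exists_le_pow_of_forall_exists_le_mul {u : ℕ → ℝ} {b : ℝ} (hb : 0 ≤ b)
    (hu : ∀ n, ∃ N, n < N ∧ u N ≤ b * u n) (k : ℕ) : ∃ N, k ≤ N ∧ u N ≤ b ^ k * u 0 := by
  induction k with
  | zero => exact ⟨0, le_rfl, by simp⟩
  | succ k ih =>
    obtain ⟨N, hkN, hN⟩ := ih
    obtain ⟨N', hNN', hN'⟩ := hu N
    refine ⟨N', by omega, hN'.trans ?_⟩
    rw [pow_succ', mul_assoc]
    gcongr

lemma liminf_coe_eq_zero_of_forall_exists_le_mul {u : ℕ → ℝ} (hu0 : ∀ n, 0 ≤ u n) {b : ℝ}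
    (hb0 : 0 ≤ b) (hb1 : b < 1) (hu : ∀ n, ∃ N, n < N ∧ u N ≤ b * u n) :
    liminf (fun n => (u n : EReal)) atTop = 0 := by
  apply le_antisymm
  · refine EReal.le_of_forall_lt_iff_le.1 fun ε hε => ?_
    have hε0 : 0 < ε := by exact_mod_cast hε
    have hpow : Tendsto (fun k : ℕ => b ^ k * u 0) atTop (𝓝 0) := by
      simpa only [zero_mul] using
        (tendsto_pow_atTop_nhds_zero_of_lt_one hb0 hb1).mul_const (u 0)
    refine liminf_le_of_frequently_le' (frequently_atTop.2 fun n => ?_)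
    obtain ⟨k, hnk, hk⟩ := ((eventually_ge_atTop n).and (hpow.eventually (ge_mem_nhds hε0))).exists
    obtain ⟨N, hkN, hN⟩ := exists_le_pow_of_forall_exists_le_mul hb0 hu k
    exact ⟨N, hnk.trans hkN, by exact_mod_cast hN.trans hk⟩
  · refine le_liminf_of_le (by isBoundedDefault) (Eventually.of_forall fun n => ?_)
    exact_mod_cast hu0 n

lemma sudlerProduct_nonneg (n : ℕ) (α : ℝ) : 0 ≤ sudlerProduct n α :=
  prod_nonneg fun _ _ => abs_nonneg _

lemma sudlerProduct_pos {α : ℝ} (hα : Irrational α) (n : ℕ) : 0 < sudlerProduct n α := by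
  refine prod_pos fun r hr => abs_pos.2 (mul_ne_zero two_ne_zero (sin_ne_zero_iff.2 fun k hk => ?_))
  rw [mem_Icc] at hr
  refine (hα.natCast_mul (by omega : r ≠ 0)).ne_int k (mul_left_cancel₀ pi_ne_zero ?_)
  linarith

lemma sudlerProduct_add (n q : ℕ) (p : ℤ) (α : ℝ) :
    sudlerProduct (n + q) α =
      sudlerProduct q α * ∏ r ∈ Icc 1 n, |2 * sin (π * r * α + π * (q * α - p))| := by
  induction n with
  | zero => simp
  | succ n ih =>
    have hshift : π * (n + q + 1 : ℕ) * α =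
        π * (n + 1 : ℕ) * α + π * (q * α - p) + p * π := by
      push_cast
      ring
    rw [prod_Icc_succ_top (by omega), ← mul_assoc, ← ih, add_right_comm, sudlerProduct,
      prod_Icc_succ_top (by omega), ← sudlerProduct, hshift, sin_add_int_mul_pi, abs_mul, abs_mul,
      abs_mul, abs_neg_one_zpow, one_mul]

lemma liminf_sudlerProduct_eq_zero {α : ℝ} (hα : Irrational α)
    (h : ∀ Q : ℕ, ∃ q : ℕ, Q ≤ q ∧ sudlerProduct q α ≤ 1 / 2 ∧ ∃ p : ℤ, |q * α - p| ≤ 1 / q) :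
    liminf (fun n => (sudlerProduct n α : EReal)) atTop = 0 := by
  refine liminf_coe_eq_zero_of_forall_exists_le_mul (fun n => sudlerProduct_nonneg n α)
    (by norm_num : (0 : ℝ) ≤ 3 / 4) (by norm_num) fun n => ?_
  set shifted : ℝ → ℝ := fun ε => ∏ r ∈ Icc 1 n, |2 * sin (π * r * α + π * ε)| with shifted_def
  have hcont : Continuous shifted := by fun_prop
  have hzero : shifted 0 = sudlerProduct n α := by
    simp only [shifted_def, mul_zero, add_zero, sudlerProduct]
  have hlt : shifted 0 < 3 / 2 * sudlerProduct n α := by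
    linarith [sudlerProduct_pos hα n]
  obtain ⟨η, hη, hshifted⟩ := Metric.eventually_nhds_iff.1
    (hcont.continuousAt.eventually (gt_mem_nhds hlt))
  obtain ⟨Q, hQ⟩ := exists_nat_gt (1 / η)
  obtain ⟨q, hQq, hhalf, p, hp⟩ := h (Q + 1)
  have hq0 : (0 : ℝ) < q := by exact_mod_cast (by omega : 0 < q)
  have hclose : dist (q * α - p) 0 < η := by
    rw [dist_eq, sub_zero]
    refine hp.trans_lt ?_
    rw [div_lt_comm₀ hq0 hη]
    exact hQ.trans_le (by exact_mod_cast (by omega : Q ≤ q))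
  refine ⟨n + q, by omega, ?_⟩
  calc sudlerProduct (n + q) α = sudlerProduct q α * shifted (q * α - p) :=
        sudlerProduct_add n q p α
    _ ≤ 1 / 2 * (3 / 2 * sudlerProduct n α) :=
        mul_le_mul hhalf (hshifted hclose).le (prod_nonneg fun _ _ => abs_nonneg _) (by norm_num)
    _ = 3 / 4 * sudlerProduct n α := by ring

end Liminf

section Convergents

open GenContFract
open GenContFract (of)

variable {K : Type*} [Field K] [LinearOrder K] [FloorRing K]

lemma exists_int_contsAux_of (v : K) (n : ℕ) : ∃ A B : ℤ, (of v).contsAux n = ⟨A, B⟩ := by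
  induction n using Nat.strong_induction_on with
  | _ n ih =>
    match n with
    | 0 => exact ⟨1, 0, by simp [contsAux]⟩
    | 1 => exact ⟨⌊v⌋, 1, by simp [contsAux, of_h_eq_floor]⟩
    | n + 2 =>
      obtain ⟨A, B, h⟩ := ih n (by omega)
      obtain ⟨A', B', h'⟩ := ih (n + 1) (by omega)
      rcases hs : (of v).s.get? n with _ | gp
      · exact ⟨A', B', by rw [contsAux_stable_step_of_terminated hs, h']⟩
      · obtain ⟨hnum, z, hz⟩ := of_partNum_eq_one_and_exists_int_partDen_eq hs
        refine ⟨z * A' + A, z * B' + B, ?_⟩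
        rw [contsAux_recurrence hs h h', hnum, hz]
        push_cast
        simp only [one_mul]

variable [IsStrictOrderedRing K]

lemma dens_of_monotone (v : K) : Monotone (of v).dens :=
  monotone_nat_of_le_succ fun _ => of_den_mono

lemma one_le_dens_of (v : K) (n : ℕ) : 1 ≤ (of v).dens n :=
  zeroth_den_eq_one.symm.le.trans (dens_of_monotone v n.zero_le)

lemma exists_rat_eq_convs_den_eq_dens {v : K} {n : ℕ} (hn : ¬(of v).TerminatedAt n) :
    ∃ r : ℚ, (r : K) = (of v).convs n ∧ (r.den : K) = (of v).dens n := by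
  obtain ⟨A, B, h⟩ := exists_int_contsAux_of v (n + 1)
  obtain ⟨A', B', h'⟩ := exists_int_contsAux_of v (n + 2)
  have hA : (of v).nums n = A := congrArg Pair.a h
  have hB : (of v).dens n = B := congrArg Pair.b h
  have hA' : (of v).nums (n + 1) = A' := congrArg Pair.a h'
  have hB' : (of v).dens (n + 1) = B' := congrArg Pair.b h'
  have hdet : A * B' - B * A' = (-1) ^ (n + 1) := by
    have : (of v).nums n * (of v).dens (n + 1) - (of v).dens n * (of v).nums (n + 1) =
        (-1) ^ (n + 1) := (SimpContFract.of v).determinant hn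
    rw [hA, hB, hA', hB'] at this
    exact_mod_cast this
  have hB0 : 0 < B := by
    have : (1 : K) ≤ B := hB ▸ one_le_dens_of v n
    exact_mod_cast zero_lt_one.trans_le this
  have hcop : IsCoprime A B := by
    refine ⟨(-1) ^ (n + 1) * B', -((-1) ^ (n + 1) * A'), ?_⟩
    have hsq : (-1 : ℤ) ^ (n + 1) * (-1) ^ (n + 1) = 1 := by
      rw [← mul_pow, neg_one_mul, neg_neg, one_pow]
    linear_combination (-1 : ℤ) ^ (n + 1) * hdet + hsq
  refine ⟨A / B, ?_, ?_⟩
  · rw [conv_eq_num_div_den, hA, hB]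
    push_cast
    rfl
  · rw [hB]
    exact_mod_cast Rat.den_div_eq_of_coprime hB0 (Int.isCoprime_iff_gcd_eq_one.1 hcop)

lemma contsAux_of_b_le_dens (v : K) (n : ℕ) : ((of v).contsAux n).b ≤ (of v).dens n := by
  cases n with
  | zero => simp [contsAux]
  | succ n => exact of_den_mono

lemma one_div_add_two_mul_sq_le_abs_sub_convs {v : K} {n : ℕ} {b : K}
    (hb : (of v).partDens.get? n = some b) :
    1 / ((b + 2) * (of v).dens n ^ 2) ≤ |v - (of v).convs n| := by
  obtain ⟨gp, hs, hgp⟩ := exists_s_b_of_partDen hb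
  obtain ⟨ifp', hst', hb'⟩ := IntFractPair.exists_succ_get?_stream_of_gcf_of_get?_eq_some hs
  obtain ⟨ifp, hst, hfr, hof⟩ := IntFractPair.succ_nth_stream_eq_some_iff.1 hst'
  have hdens : 0 < (of v).dens n := zero_lt_one.trans_le (one_le_dens_of v n)
  have hprev : ((of v).contsAux n).b ≤ (of v).dens n := contsAux_of_b_le_dens v n
  have hprev0 : 0 ≤ ((of v).contsAux n).b := zero_le_of_contsAux_b
  have hfr0 : 0 < ifp.fr⁻¹ :=
    inv_pos.2 (lt_of_le_of_ne (IntFractPair.nth_stream_fr_nonneg hst) hfr.symm)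
  have hfr_lt : ifp.fr⁻¹ < b + 1 := by
    have hfloor : (⌊ifp.fr⁻¹⌋ : K) = b := by rw [← hgp, ← hb', ← hof]; rfl
    rw [← hfloor]
    exact Int.lt_floor_add_one _
  have heq : |v - (of v).convs n| =
      1 / ((of v).dens n * (ifp.fr⁻¹ * (of v).dens n + ((of v).contsAux n).b)) := by
    have h := sub_convs_eq hst
    simp only [hfr, if_false] at h
    rw [h, abs_div, abs_neg_one_pow]
    congr 1
    exact abs_of_pos (mul_pos hdens (by positivity))
  rw [heq]
  refine one_div_le_one_div_of_le (by positivity) ?_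
  calc (of v).dens n * (ifp.fr⁻¹ * (of v).dens n + ((of v).contsAux n).b)
      ≤ (of v).dens n * ((b + 1) * (of v).dens n + (of v).dens n) := by gcongr
    _ = (b + 2) * (of v).dens n ^ 2 := by ring

end Convergents

section PartialQuotients

open GenContFract (of)

variable {α : ℝ} {a : ℕ → ℕ}

lemma HasContFracCoeffs.not_terminatedAt (h : HasContFracCoeffs α a) (n : ℕ) :
    ¬(of α).TerminatedAt n := by
  rw [GenContFract.terminatedAt_iff_partDen_none, h.coeff n]
  exact Option.some_ne_none _

lemma HasContFracCoeffs.irrational (h : HasContFracCoeffs α a) : Irrational α := by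
  rintro ⟨r, hr⟩
  obtain ⟨n, hn⟩ := (GenContFract.terminates_iff_rat α).2 ⟨r, hr.symm⟩
  exact h.not_terminatedAt n hn

lemma HasContFracCoeffs.exists_rat_den_eq_dens (h : HasContFracCoeffs α a) (n : ℕ) :
    ∃ r : ℚ, (r.den : ℝ) = (of α).dens n ∧ n ≤ r.den ∧
      |α - r| ≤ 1 / (a (n + 1) * (r.den : ℝ) ^ 2) := by
  obtain ⟨r, hr, hden⟩ := exists_rat_eq_convs_den_eq_dens (h.not_terminatedAt n)
  refine ⟨r, hden, ?_, ?_⟩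
  · have hfib : Nat.fib (n + 1) ≤ r.den := by
      have := GenContFract.succ_nth_fib_le_of_nth_den (.inr (h.not_terminatedAt (n - 1)))
      rw [← hden] at this
      exact_mod_cast this
    have := Nat.le_fib_add_one (n + 1)
    omega
  · have hle := GenContFract.abs_sub_convergents_le' (h.coeff n)
    rwa [← hr, ← hden, mul_assoc, ← sq] at hle

lemma HasContFracCoeffs.exists_convergent_of_abs_mul_sub_lt (h : HasContFracCoeffs α a) {m : ℕ}
    (hm : 1 ≤ m) {k : ℤ} (hmk : |m * α - k| < 1 / (2 * m)) :
    ∃ n, (of α).dens n ≤ m ∧ m / ((a (n + 1) + 2) * (of α).dens n ^ 2) ≤ |m * α - k| := by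
  have : (0 : ℝ) < m := by exact_mod_cast hm
  obtain ⟨r, hr⟩ : ∃ r : ℚ, r = k / m := ⟨_, rfl⟩
  have hr' : (r : ℝ) = k / m := by rw [hr]; push_cast; rfl
  have hden : (r.den : ℝ) ≤ m := by
    have hdvd : r.den ∣ m := by
      rw [hr]
      exact_mod_cast Rat.den_dvd k m
    exact_mod_cast Nat.le_of_dvd hm hdvd
  have hden0 : (0 : ℝ) < r.den := by exact_mod_cast r.den_pos
  have hdist : |m * α - k| = m * |α - r| := by
    rw [hr', show m * α - k = m * (α - k / m) by field_simp, abs_mul, Nat.abs_cast]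
  have hclose : |α - r| < 1 / (2 * (r.den : ℝ) ^ 2) := by
    calc |α - r| = |m * α - k| / m := by rw [hdist]; field_simp
      _ < 1 / (2 * m) / m := by gcongr
      _ = 1 / (2 * (m : ℝ) ^ 2) := by field_simp
      _ ≤ 1 / (2 * (r.den : ℝ) ^ 2) := by gcongr
  obtain ⟨n, hn⟩ := exists_convs_eq_rat hclose
  obtain ⟨r', hr'n, hdens⟩ := exists_rat_eq_convs_den_eq_dens (h.not_terminatedAt n)
  obtain rfl : r' = r := by exact_mod_cast hr'n.trans hn
  refine ⟨n, hdens ▸ hden, ?_⟩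
  rw [hdist, ← hn, ← mul_one_div]
  gcongr
  exact one_div_add_two_mul_sq_le_abs_sub_convs (h.coeff n)

lemma HasContFracCoeffs.exists_forall_min_le_abs_mul_sub (h : HasContFracCoeffs α a) (n₀ : ℕ) :
    ∃ c : ℝ, 0 < c ∧ ∀ N, (∀ i, n₀ ≤ i → i ≤ N + 1 → a i ≤ a (N + 1)) → ∀ m : ℕ, 1 ≤ m →
      m < (of α).dens N → ∀ k : ℤ, min c (1 / ((a (N + 1) + 2) * m)) ≤ |m * α - k| := by
  obtain ⟨A, hA⟩ : ∃ A : ℕ, ∀ i < n₀, a i ≤ A :=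
    ⟨(range n₀).sup a, fun i hi => le_sup (mem_range.2 hi)⟩
  set D := (of α).dens n₀
  have hdens (n : ℕ) : 0 < (of α).dens n := zero_lt_one.trans_le (one_le_dens_of α n)
  refine ⟨1 / ((A + 2) * D ^ 2), by have := hdens n₀; positivity, fun N hmax m hm hmN k => ?_⟩
  have hm1 : (1 : ℝ) ≤ m := by exact_mod_cast hm
  rcases le_or_gt (1 / (2 * (m : ℝ))) |m * α - k| with hfar | hclose
  · refine (min_le_right _ _).trans (le_trans ?_ hfar)
    gcongr
    exact le_add_of_nonneg_left (Nat.cast_nonneg _)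
  obtain ⟨n, hnm, hn⟩ := h.exists_convergent_of_abs_mul_sub_lt hm hclose
  have hnN : n < N := (dens_of_monotone α).reflect_lt (hnm.trans_lt hmN)
  have hn0 := hdens n
  refine le_trans ?_ hn
  rcases lt_or_ge (n + 1) n₀ with hlt | hge
  · refine (min_le_left _ _).trans ?_
    gcongr
    · exact_mod_cast hA (n + 1) hlt
    · exact dens_of_monotone α (by omega)
  · have hquot : (a (n + 1) : ℝ) ≤ a (N + 1) := by exact_mod_cast hmax (n + 1) hge (by omega)
    refine (min_le_right _ _).trans ?_
    calc 1 / ((a (N + 1) + 2) * m) = m / ((a (N + 1) + 2) * (m : ℝ) ^ 2) := by field_simp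
      _ ≤ m / ((a (n + 1) + 2) * (of α).dens n ^ 2) := by gcongr

end PartialQuotients

lemma exists_frequently_forall_le {a : ℕ → ℕ} {K : ℕ} (hK : ∃ᶠ n in atTop, K ≤ a n) :
    ∃ n₀, ∃ᶠ n in atTop, K ≤ a n ∧ ∀ i, n₀ ≤ i → i ≤ n → a i ≤ a n := by
  classical
  by_cases hbdd : ∃ v, ¬∃ᶠ n in atTop, v ≤ a n
  · obtain ⟨v, hv, hmin⟩ : ∃ v, (¬∃ᶠ n in atTop, v ≤ a n) ∧ ∀ w < v, ∃ᶠ n in atTop, w ≤ a n :=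
      ⟨Nat.find hbdd, Nat.find_spec hbdd, fun w hw => not_not.1 (Nat.find_min hbdd hw)⟩
    obtain ⟨n₀, hn₀⟩ := eventually_atTop.1 (not_frequently.1 hv)
    have hKv : K < v := by
      by_contra! hvK
      exact hv (hK.mono fun n hn => hvK.trans hn)
    refine ⟨n₀, (hmin (v - 1) (by omega)).mono fun n hn => ⟨by omega, fun i hi _ => ?_⟩⟩
    have := hn₀ i hi
    omega
  · push Not at hbdd
    refine ⟨0, frequently_atTop.2 fun N => ?_⟩
    have hex := frequently_atTop.1 (hbdd ((range N).sup a + K)) N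
    obtain ⟨hN, hlarge⟩ := Nat.find_spec hex
    refine ⟨Nat.find hex, hN, by omega, fun i _ hi => ?_⟩
    rcases lt_or_ge i N with hiN | hNi
    · have := le_sup (f := a) (mem_range.2 hiN)
      omega
    · rcases hi.eq_or_lt with rfl | hi
      · rfl
      · have := not_and.1 (Nat.find_min hex hi) hNi
        omega

theorem theorem5p1_general {α : ℝ} {a : ℕ → ℕ} (h : HasContFracCoeffs α a) {K : ℕ}
    (hK : exp 150 ≤ K) (hfreq : ∃ᶠ j in atTop, K ≤ a j) :
    liminf (fun n : ℕ => (sudlerProduct n α : EReal)) atTop = 0 := by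
  obtain ⟨n₀, hrecord⟩ := exists_frequently_forall_le hfreq
  obtain ⟨c, hc, happrox⟩ := h.exists_forall_min_le_abs_mul_sub n₀
  obtain ⟨Q₀, hsmall⟩ := exists_forall_sudlerProduct_le_half hc
  refine liminf_sudlerProduct_eq_zero h.irrational fun Q => ?_
  obtain ⟨j, hj, hKj, hmax⟩ := frequently_atTop.1 hrecord (max Q Q₀ + 1)
  obtain ⟨N, rfl⟩ : ∃ N, j = N + 1 := ⟨j - 1, by omega⟩
  obtain ⟨r, hden, hNr, hr⟩ := h.exists_rat_den_eq_dens N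
  have hL : exp 150 ≤ a (N + 1) := hK.trans (by exact_mod_cast hKj)
  have hhalf : sudlerProduct r.den α ≤ 1 / 2 := by
    refine hsmall _ hL r.den (by omega) r.num α (Rat.isCoprime_num_den r) ?_ fun m hm hmr =>
      happrox N hmax m hm (hden ▸ by exact_mod_cast hmr)
    rwa [← Rat.cast_def]
  refine ⟨r.den, by omega, hhalf, r.num, ?_⟩
  have hden0 : (0 : ℝ) < r.den := by exact_mod_cast r.den_pos
  have hL1 : (1 : ℝ) ≤ a (N + 1) := (one_le_exp (by norm_num)).trans hL
  calc |r.den * α - r.num| = r.den * |α - r| := by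
        rw [Rat.cast_def r, ← abs_of_pos hden0, ← abs_mul, abs_of_pos hden0]
        congr 1
        field_simp
    _ ≤ r.den * (1 / (1 * (r.den : ℝ) ^ 2)) := by
        refine mul_le_mul_of_nonneg_left (hr.trans ?_) hden0.le
        gcongr
    _ = 1 / r.den := by field_simp

theorem theorem5p1 :
    (∃ M₀ : ℕ, ∀ M : ℕ, M₀ ≤ M → ∃ K : ℕ, 1 ≤ K ∧ K ≤ M ∧
      ∀ (α : ℝ) (a : ℕ → ℕ), HasContFracCoeffs α a → IsGreatest (a '' Set.Ici 1) M →
        (∃ᶠ j in Filter.atTop, K ≤ a j) →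
          Filter.liminf (fun n : ℕ => (sudlerProduct n α : EReal)) Filter.atTop = 0) ∧
    (∀ M K : ℕ, 1 ≤ K → K ≤ M →
      802 + 151 * Real.log (M : ℝ) / (K : ℝ) - Real.log (K : ℝ) < 0 →
        ∀ (α : ℝ) (a : ℕ → ℕ), HasContFracCoeffs α a → IsGreatest (a '' Set.Ici 1) M →
          (∃ᶠ j in Filter.atTop, K ≤ a j) →
            Filter.liminf (fun n : ℕ => (sudlerProduct n α : EReal)) Filter.atTop = 0) := by
  constructor
  · obtain ⟨K, hK⟩ := exists_nat_ge (exp 150)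
    have hK1 : 1 ≤ K := by exact_mod_cast (one_le_exp (by norm_num)).trans hK
    exact ⟨K, fun M hM => ⟨K, hK1, hM, fun α a h _ hfreq => theorem5p1_general h hK hfreq⟩⟩
  · intro M K hK1 _ hlog α a h _ hfreq
    refine theorem5p1_general h ?_ hfreq
    rw [← le_log_iff_exp_le (by exact_mod_cast hK1)]
    have : 0 ≤ log M := log_natCast_nonneg M
    have hterm : 0 ≤ 151 * log M / K := by positivity
    linarith
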